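/- For integers $n\ge 1$ and $j\ge 1$, let $H(n,j)$ be the graph with vertex set $\mathbb{Z}_2^n$ in which two vectors are adjacent if and only if their Hamming distance is $j$. A quantum $c$-coloring of a finite graph $G=(V,E)$ consists of an integer $d\ge 1$ and orthogonal projections $P_{v,i}:\mathbb{C}^d\to\mathbb{C}^d$ $(v\in V,\ 1\le i\le c)$ such that $\sum_{i=1}^{c}P_{v,i}=I_d$ for every $v\in V$, and $P_{v,i}P_{w,i}=0$ for all $1\le i\le c$ whenever $v$ and $w$ are adjacent. The quantum chromatic number $\chi_q(G)$ is the smallest $c$ for which $G$ admits a quantum $c$-coloring. Let $h(x)=-x\log_2 x-(1-x)\log_2(1-x)$ for $0<x<1$. (1) For every fixed even integer $j\ge 2$ one has $\chi_q(H(n,j))=\Omega(n^{j/2})$: there are a constant $c>0$ and an integer $N$, depending only on $j$, such that $\chi_q(H(n,j))\ge c\,n^{j/2}$ for all $n\ge N$. (2) There are an absolute constant $c>0$ and an absolute integer $N$ such that for every real $\alpha$ with $0<\alpha\le 0.17$, every $n\ge N$ and every even integer $j$ with $j=\alpha n$, $$\chi_q(H(n,j))\ \ge\ c\left(\frac{2^{h(\alpha)}}{\left(e(1+\sqrt2)\sqrt{(1-\alpha)/\alpha}\right)^{\alpha}}\right)^{n}.$$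 -/

import Mathlib

/-- The binary distance-`j` Hamming graph `H(n, j)`: the vertices are the vectors of `(ℤ/2)ⁿ`, and
two vertices are adjacent iff their Hamming distance is `j`. (The clause `u ≠ v` is automatic for
`0 < j`; it only excludes loops for `j = 0`.) -/
def hammingGraph (n j : ℕ) : SimpleGraph (Fin n → ZMod 2) where
  Adj u v := u ≠ v ∧ hammingDist u v = j
  symm := ⟨fun u v h => ⟨h.1.symm, by rw [hammingDist_comm]; exact h.2⟩⟩
  loopless := ⟨fun _ h => h.1 rfl⟩

/-- A family `P v i` of complex `d × d` matrices is a quantum `c`-coloring of `G` in dimension `d`: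
every `P v i` is an orthogonal projection (a self-adjoint idempotent), `∑ i, P v i = 1` for every
vertex `v`, and `P v i * P w i = 0` for every color `i` whenever `v` and `w` are adjacent. -/
structure IsQuantumColoring {V : Type*} (G : SimpleGraph V) (c d : ℕ)
    (P : V → Fin c → Matrix (Fin d) (Fin d) ℂ) : Prop where
  isStarProjection : ∀ v i, IsStarProjection (P v i)
  sum_eq_one : ∀ v, ∑ i, P v i = 1
  mul_eq_zero : ∀ v w, G.Adj v w → ∀ i, P v i * P w i = 0

/-- `G` admits a quantum `c`-coloring, in some dimension `d ≥ 1`. -/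
def QuantumColorable {V : Type*} (G : SimpleGraph V) (c : ℕ) : Prop :=
  ∃ (d : ℕ) (P : V → Fin c → Matrix (Fin d) (Fin d) ℂ), 0 < d ∧ IsQuantumColoring G c d P

/-- Every classical coloring is a quantum coloring in dimension one. In particular a finite graph
has some quantum coloring. -/
theorem QuantumColorable.of_colorable {V : Type*} {G : SimpleGraph V} {c : ℕ}
    (h : G.Colorable c) : QuantumColorable G c := by
  obtain ⟨C⟩ := h
  refine ⟨1, fun v i => if C v = i then 1 else 0, one_pos, ⟨?_, ?_, ?_⟩⟩
  · intro v i
    split_ifs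
    · exact IsStarProjection.one _
    · exact IsStarProjection.zero _
  · intro v
    simp
  · intro v w hvw i
    have := C.valid hvw
    by_cases h1 : C v = i <;> by_cases h2 : C w = i <;> simp_all

/-- The quantum chromatic number of a finite graph `G`: the smallest `c` such that `G` admits a
quantum `c`-coloring. -/
noncomputable def quantumChromaticNumber {V : Type*} [Finite V] (G : SimpleGraph V) : ℕ :=
  sInf {c : ℕ | QuantumColorable G c}

/-- The binary entropy function (logarithms to base two). -/
noncomputable def binaryEntropy (x : ℝ) : ℝ :=
  -x * Real.logb 2 x - (1 - x) * Real.logb 2 (1 - x)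

/-! The engine is a Hoffman bound for quantum colorings: if the least adjacency eigenvalue is at
least `-m`, then `n.choose j + m ≤ c * m`. Characters diagonalize `H(n, j)`, and its eigenvalues are
Krawtchouk values `K_j`, so what is needed is a lower bound on `K_j` for even `j` (`neg_le`). Write
`S = n - 2w`. If `S ^ 2 ≥ 4j(n - j)`, the recurrence in the degree keeps all terms up to `j`
positive when `S > 0`; evenness of `j` covers `S < 0`. Otherwise `|S|` is small, and a Grönwall
estimate of the generating function of `|K_k|` gives `|K_j| ≤ exp(|S|r + nr²/2) / r ^ j` for every
`r > 0`. With `r = t * √(j / n)` the exponent is linear in `j`. Taking `t = 1` gives (1); taking `t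
= √2 - 1`, with Stirling's formula for `n.choose j`, gives (2), where a spare factor `exp(-j/20)`
absorbs the `√j` lost to Stirling. -/

/-! ### Krawtchouk values: positivity and size estimates -/

/-- The three-term recurrence in the degree `k` satisfied by the values `K_k(w)` of the binary
Krawtchouk polynomials of length `n` at a fixed point `w`, where `S = n - 2 * w`. -/
structure IsKrawtchoukSeq (n : ℕ) (S : ℝ) (a : ℕ → ℝ) : Prop where
  zero : a 0 = 1
  one : a 1 = S
  add_two : ∀ k : ℕ, ((k : ℝ) + 2) * a (k + 2) = S * a (k + 1) - ((n : ℝ) - k) * a k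

namespace IsKrawtchoukSeq

variable {n : ℕ} {S : ℝ} {a : ℕ → ℝ}

/-- Complementing the weight, `w ↦ n - w`, reverses the sign of `S`; for even degree the value is
unchanged. -/
theorem neg (h : IsKrawtchoukSeq n S a) :
    IsKrawtchoukSeq n (-S) (fun k => (-1) ^ k * a k) where
  zero := by simp [h.zero]
  one := by simp [h.one]
  add_two k := by
    have := h.add_two k
    simp only [pow_succ]
    linear_combination (-1) ^ k * this

/-- Beyond the oscillatory region the ratios of consecutive terms stay at least `S / 2`. -/
theorem pos_and_ratio (h : IsKrawtchoukSeq n S a) {j : ℕ} (hj : 3 * j ≤ n + 2) (hS : 0 < S)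
    (hS2 : 4 * (j * ((n : ℝ) - j)) ≤ S ^ 2) :
    ∀ k : ℕ, k + 1 ≤ j → 0 < a k ∧ S / 2 * a k ≤ ((k : ℝ) + 1) * a (k + 1)
  | 0, _ => by simp only [h.zero, h.one, zero_add, Nat.cast_zero]; constructor <;> linarith
  | k + 1, hk => by
    obtain ⟨h1, h2⟩ := h.pos_and_ratio hj hS hS2 k (by omega)
    have hpos : 0 < a (k + 1) := by
      have : 0 < ((k : ℝ) + 1) * a (k + 1) := lt_of_lt_of_le (by positivity) h2
      exact pos_of_mul_pos_right this (by positivity)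
    refine ⟨hpos, ?_⟩
    have hrec := h.add_two k
    have hj' : (3 : ℝ) * j ≤ n + 2 := by exact_mod_cast hj
    have hk' : (k : ℝ) + 2 ≤ j := by exact_mod_cast hk
    have hk0 : (0 : ℝ) ≤ k := k.cast_nonneg
    -- At the extreme case `k + 2 = j` this inequality is exactly `3 * j ≤ n + 2`.
    have hmono : ((k : ℝ) + 1) * (n - k) ≤ j * ((n : ℝ) - j) := by
      nlinarith [mul_nonneg (sub_nonneg.2 hk') (show (0 : ℝ) ≤ n - j - (k + 1) by linarith)]
    have hnk : (0 : ℝ) ≤ n - k := by linarith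
    -- The ratio `S / 2` reproduces itself: it is the double root of `x² - S x + S² / 4`, and `(k +
    -- 1)(n - k) ≤ S² / 4`.
    have key : S / 2 * (((n : ℝ) - k) * a k) ≤ S / 2 * (S / 2 * a (k + 1)) := by
      calc S / 2 * (((n : ℝ) - k) * a k) = ((n : ℝ) - k) * (S / 2 * a k) := by ring
        _ ≤ ((n : ℝ) - k) * (((k : ℝ) + 1) * a (k + 1)) := by gcongr
        _ = (((k : ℝ) + 1) * (n - k)) * a (k + 1) := by ring
        _ ≤ (S ^ 2 / 4) * a (k + 1) := by gcongr; linarith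
        _ = _ := by ring
    have := le_of_mul_le_mul_left key (by positivity)
    push_cast
    have e : ((k : ℝ) + 1 + 1) * a (k + 1 + 1) = ((k : ℝ) + 2) * a (k + 2) := by ring_nf
    rw [e, hrec]
    linarith

theorem pos_of_large (h : IsKrawtchoukSeq n S a) {j : ℕ} (hj0 : 0 < j) (hj : 3 * j ≤ n + 2)
    (hS : 0 < S) (hS2 : 4 * (j * ((n : ℝ) - j)) ≤ S ^ 2) : 0 < a j := by
  obtain ⟨k, rfl⟩ : ∃ k, j = k + 1 := ⟨j - 1, by omega⟩
  obtain ⟨h1, h2⟩ := h.pos_and_ratio hj hS hS2 k le_rfl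
  have : 0 < ((k : ℝ) + 1) * a (k + 1) := lt_of_lt_of_le (by positivity) h2
  exact pos_of_mul_pos_right this (by positivity)

theorem nonneg_of_large (h : IsKrawtchoukSeq n S a) {j : ℕ} (hj0 : 0 < j) (hje : Even j)
    (hj : 3 * j ≤ n + 2) (hS2 : 4 * (j * ((n : ℝ) - j)) ≤ S ^ 2) : 0 ≤ a j := by
  have hj2 : 2 ≤ j := by obtain ⟨i, rfl⟩ := hje; omega
  rcases lt_trichotomy S 0 with hS | hS | hS
  · have := h.neg.pos_of_large hj0 hj (neg_pos.2 hS) (by simpa using hS2)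
    simpa [hje.neg_one_pow] using this.le
  · exfalso
    have h1 : (2 : ℝ) ≤ j := by exact_mod_cast hj2
    have h2 : (3 : ℝ) * j ≤ n + 2 := by exact_mod_cast hj
    have : (0 : ℝ) < j * ((n : ℝ) - j) := mul_pos (by linarith) (by linarith)
    rw [hS] at hS2
    linarith
  · exact (h.pos_of_large hj0 hj hS hS2).le

theorem abs_recurrence (h : IsKrawtchoukSeq n S a) {k : ℕ} (hk : k ≤ n) :
    ((k : ℝ) + 2) * |a (k + 2)| ≤ |S| * |a (k + 1)| + n * |a k| := by
  have hk' : (k : ℝ) ≤ n := by exact_mod_cast hk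
  calc ((k : ℝ) + 2) * |a (k + 2)| = |S * a (k + 1) - ((n : ℝ) - k) * a k| := by
        rw [← h.add_two k, abs_mul, abs_of_nonneg (by positivity : (0 : ℝ) ≤ (k : ℝ) + 2)]
    _ ≤ |S * a (k + 1)| + |((n : ℝ) - k) * a k| := abs_sub _ _
    _ = |S| * |a (k + 1)| + ((n : ℝ) - k) * |a k| := by
        rw [abs_mul, abs_mul, abs_of_nonneg (sub_nonneg.2 hk')]
    _ ≤ _ := by gcongr; linarith [k.cast_nonneg (α := ℝ)]

/-- Grönwall: taking absolute values in the recurrence gives `F' ≤ (|S| + n x) F` for the truncated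
generating function `F`, with `F 0 = 1`. Truncating at degree `n + 1` uses the recurrence only where
`n - k ≥ 0`. -/
theorem sum_abs_mul_pow_le (h : IsKrawtchoukSeq n S a) {r : ℝ} (hr : 0 ≤ r) :
    ∑ k ∈ Finset.range (n + 2), |a k| * r ^ k ≤ Real.exp (|S| * r + n * r ^ 2 / 2) := by
  set F : ℝ → ℝ := fun x => ∑ k ∈ Finset.range (n + 2), |a k| * x ^ k with hF
  set F' : ℝ → ℝ := fun x => ∑ k ∈ Finset.range (n + 2), |a k| * (k * x ^ (k - 1)) with hF'
  have hderiv : ∀ x, HasDerivAt F (F' x) x := fun x =>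
    HasDerivAt.fun_sum fun k _ => (hasDerivAt_pow k x).const_mul _
  have hle : ∀ x, 0 ≤ x → F' x ≤ (|S| + n * x) * F x := by
    intro x hx
    have e1 : F' x = |a 1| + ∑ k ∈ Finset.range n, ((k : ℝ) + 2) * |a (k + 2)| * x ^ (k + 1) := by
      simp only [hF', Finset.sum_range_succ' _ (n + 1), Finset.sum_range_succ' _ n]
      simp only [Nat.cast_zero, zero_mul, mul_zero, add_zero, zero_add, Nat.cast_one, Nat.sub_self,
        pow_zero, mul_one, Nat.add_sub_cancel]
      rw [add_comm]
      congr 1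
      refine Finset.sum_congr rfl fun k _ => ?_
      push_cast
      ring
    have e2 : F x = |a 0| + ∑ k ∈ Finset.range (n + 1), |a (k + 1)| * x ^ (k + 1) := by
      simp only [hF, Finset.sum_range_succ' _ (n + 1), pow_zero, mul_one]
      rw [add_comm]
    have e3 : ∑ k ∈ Finset.range n, |a (k + 1)| * x ^ (k + 1) ≤
        ∑ k ∈ Finset.range (n + 1), |a (k + 1)| * x ^ (k + 1) :=
      Finset.sum_le_sum_of_subset_of_nonneg (by simp) fun _ _ _ => by positivity
    have e4 : ∑ k ∈ Finset.range n, |a k| * x ^ k ≤ F x :=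
      Finset.sum_le_sum_of_subset_of_nonneg (by simp) fun _ _ _ => by positivity
    have e5 : ∑ k ∈ Finset.range n, ((k : ℝ) + 2) * |a (k + 2)| * x ^ (k + 1) ≤
        |S| * ∑ k ∈ Finset.range n, |a (k + 1)| * x ^ (k + 1) +
          n * x * ∑ k ∈ Finset.range n, |a k| * x ^ k := by
      rw [Finset.mul_sum, Finset.mul_sum, ← Finset.sum_add_distrib]
      refine Finset.sum_le_sum fun k hk => ?_
      have := h.abs_recurrence (Finset.mem_range.1 hk).le
      calc ((k : ℝ) + 2) * |a (k + 2)| * x ^ (k + 1)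
          ≤ (|S| * |a (k + 1)| + n * |a k|) * x ^ (k + 1) := by gcongr
        _ = _ := by ring
    calc F' x ≤ |S| + (|S| * (∑ k ∈ Finset.range (n + 1), |a (k + 1)| * x ^ (k + 1)) +
          n * x * F x) := by
          rw [e1, h.one]
          gcongr
          exact e5.trans (by gcongr)
      _ = _ := by
        have : |a 0| = 1 := by simp [h.zero]
        rw [add_mul, e2, this]; ring
  have hG : ∀ x, HasDerivAt (fun y => F y * Real.exp (-(|S| * y + n * y ^ 2 / 2)))
      ((F' x - (|S| + n * x) * F x) * Real.exp (-(|S| * x + n * x ^ 2 / 2))) x := by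
    intro x
    have h1 : HasDerivAt (fun y : ℝ => -(|S| * y + n * y ^ 2 / 2)) (-(|S| + n * x)) x := by
      have := (((hasDerivAt_id x).const_mul |S|).add
        (((hasDerivAt_pow 2 x).const_mul (n : ℝ)).div_const 2)).neg
      refine this.congr_deriv ?_
      push_cast
      ring
    refine ((hderiv x).mul h1.exp).congr_deriv ?_
    ring
  have hanti : AntitoneOn (fun y => F y * Real.exp (-(|S| * y + n * y ^ 2 / 2))) (Set.Ici 0) := by
    refine antitoneOn_of_deriv_nonpos (convex_Ici 0)
      (fun x _ => (hG x).continuousAt.continuousWithinAt)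
      (fun x _ => (hG x).differentiableAt.differentiableWithinAt) fun x hx => ?_
    rw [interior_Ici] at hx
    rw [(hG x).deriv]
    exact mul_nonpos_of_nonpos_of_nonneg (sub_nonpos.2 (hle x (Set.mem_Ioi.1 hx).le))
      (Real.exp_pos _).le
  have h0 : F 0 = 1 := by
    simp only [hF, Finset.sum_range_succ' _ (n + 1)]
    simp [h.zero]
  have := hanti (Set.mem_Ici.2 le_rfl) (Set.mem_Ici.2 hr) hr
  simp only [h0, Real.exp_neg] at this
  rw [← div_eq_mul_inv, div_le_iff₀ (Real.exp_pos _)] at this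
  simpa [hF] using this

theorem neg_le (h : IsKrawtchoukSeq n S a) {j : ℕ} (hj0 : 0 < j) (hje : Even j)
    (hj : 3 * j ≤ n + 2) {r : ℝ} (hr : 0 < r) :
    -(Real.exp (2 * √(j * ((n : ℝ) - j)) * r + n * r ^ 2 / 2) / r ^ j) ≤ a j := by
  rcases le_total (4 * (j * ((n : ℝ) - j))) (S ^ 2) with hS | hS
  · exact le_trans (by simp only [Left.neg_nonpos_iff]; positivity)
      (h.nonneg_of_large hj0 hje hj hS)
  · refine neg_le_of_abs_le ?_
    have hS' : |S| ≤ 2 * √(j * ((n : ℝ) - j)) := by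
      refine abs_le_of_sq_le_sq ?_ (by positivity)
      rw [mul_pow, Real.sq_sqrt (by nlinarith [sq_nonneg S])]
      linarith
    rw [le_div_iff₀ (by positivity)]
    calc |a j| * r ^ j ≤ ∑ k ∈ Finset.range (n + 2), |a k| * r ^ k :=
          Finset.single_le_sum (f := fun k => |a k| * r ^ k) (fun _ _ => by positivity)
            (Finset.mem_range.2 (by obtain ⟨i, rfl⟩ := hje; omega))
      _ ≤ _ := h.sum_abs_mul_pow_le hr.le
      _ ≤ _ := by gcongr

end IsKrawtchoukSeq

/-! ### Generating polynomial of the Krawtchouk values -/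

-- Logarithmic differentiation: since `x ^ 2 = 1`, each factor contributes `x / (1 + x X) = (x - X)
-- / (1 - X ^ 2)`.
open Polynomial in
theorem one_sub_X_sq_mul_derivative_prod {ι : Type*} [DecidableEq ι] (x : ι → ℝ)
    (hx : ∀ i, x i ^ 2 = 1) (s : Finset ι) :
    (1 - X ^ 2) * derivative (∏ i ∈ s, (1 + C (x i) * X)) =
      (C (∑ i ∈ s, x i) - C (s.card : ℝ) * X) * ∏ i ∈ s, (1 + C (x i) * X) := by
  induction s using Finset.induction_on with
  | empty => simp
  | insert i s hi ih =>
    rw [Finset.prod_insert hi, Finset.sum_insert hi, Finset.card_insert_of_notMem hi,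
      derivative_mul]
    have hC : C (x i) ^ 2 = (1 : ℝ[X]) := by rw [← C_pow, hx, C_1]
    simp only [derivative_add, derivative_one, derivative_C_mul, derivative_X, zero_add, mul_one,
      C_add, Nat.cast_add, Nat.cast_one, C_1]
    linear_combination (1 + C (x i) * X) * ih -
      X * (∏ i ∈ s, (1 + C (x i) * X)) * hC

open Polynomial in
theorem isKrawtchoukSeq_coeff {n : ℕ} (x : Fin n → ℝ) (hx : ∀ i, x i ^ 2 = 1) :
    IsKrawtchoukSeq n (∑ i, x i) (fun k => (∏ i, (1 + C (x i) * X)).coeff k) := by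
  set P : ℝ[X] := ∏ i, (1 + C (x i) * X) with hP
  have hd := one_sub_X_sq_mul_derivative_prod x hx Finset.univ
  rw [← hP, Finset.card_univ, Fintype.card_fin] at hd
  have h0 : P.coeff 0 = 1 := by
    rw [coeff_zero_eq_eval_zero, hP, eval_prod]
    simp
  refine ⟨h0, ?_, fun k => ?_⟩
  · have := congrArg (fun Q => coeff Q 0) hd
    simpa [sub_mul, mul_assoc, coeff_derivative, h0, mul_coeff_zero] using this
  -- The coefficient of `X ^ (k + 1)` in the differential equation is the recurrence.
  · have := congrArg (fun Q => coeff Q (k + 1)) hd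
    have hk : (X ^ 2 * derivative P).coeff (k + 1) = k * P.coeff k := by
      rw [pow_two, mul_assoc, coeff_X_mul]
      cases k with
      | zero => simp
      | succ k => rw [coeff_X_mul, coeff_derivative]; push_cast; ring
    simp only [sub_mul, one_mul, coeff_sub, mul_assoc, coeff_C_mul, coeff_X_mul, hk] at this
    rw [coeff_derivative] at this
    push_cast at this
    linear_combination this

/-! ### Fourier analysis on the cube -/

/-- The nontrivial character of `ℤ/2`. -/
def bitSign (a : ZMod 2) : ℝ := if a = 0 then 1 else -1

theorem zmod_two_eq_zero_or_one : ∀ a : ZMod 2, a = 0 ∨ a = 1 := by decide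

theorem bitSign_add (a b : ZMod 2) : bitSign (a + b) = bitSign a * bitSign b := by
  rcases zmod_two_eq_zero_or_one a with rfl | rfl <;>
    rcases zmod_two_eq_zero_or_one b with rfl | rfl <;>
    simp [bitSign, CharTwo.add_self_eq_zero]

theorem bitSign_sq (a : ZMod 2) : bitSign a ^ 2 = 1 := by
  rcases zmod_two_eq_zero_or_one a with rfl | rfl <;> simp [bitSign]

/-- The characters of `(ℤ/2)ⁿ`. -/
def cubeChar {n : ℕ} (u v : Fin n → ZMod 2) : ℝ := ∏ i, bitSign (u i * v i)

theorem cubeChar_add {n : ℕ} (u v w : Fin n → ZMod 2) :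
    cubeChar u (v + w) = cubeChar u v * cubeChar u w := by
  simp [cubeChar, mul_add, bitSign_add, Finset.prod_mul_distrib]

theorem cubeChar_zero_left {n : ℕ} (v : Fin n → ZMod 2) : cubeChar 0 v = 1 := by
  simp [cubeChar, bitSign]

theorem sum_cubeChar {n : ℕ} (v : Fin n → ZMod 2) :
    ∑ u, cubeChar u v = if v = 0 then (2 : ℝ) ^ n else 0 := by
  have h := Finset.prod_univ_sum (fun _ : Fin n => (Finset.univ : Finset (ZMod 2)))
    (fun i a => bitSign (a * v i))
  rw [Fintype.piFinset_univ] at h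
  unfold cubeChar
  rw [← h]
  have h2 : ∀ a : ZMod 2, ∑ b, bitSign (b * a) = if a = 0 then 2 else 0 := by
    intro a
    rw [show (Finset.univ : Finset (ZMod 2)) = {0, 1} from rfl, Finset.sum_pair (by decide)]
    rcases zmod_two_eq_zero_or_one a with rfl | rfl <;> simp [bitSign]
    norm_num
  simp only [h2]
  split_ifs with hv
  · simp [hv]
  · obtain ⟨i, hi⟩ := Function.ne_iff.1 hv
    exact Finset.prod_eq_zero (Finset.mem_univ i) (if_neg hi)

/-- The eigenvalues of the Hamming graph `H(n, j)`. -/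
noncomputable def hammingEigenvalue {n : ℕ} (j : ℕ) (u : Fin n → ZMod 2) : ℝ :=
  ∑ t : Fin n → ZMod 2, if hammingNorm t = j then cubeChar u t else 0

-- Expanding the product chooses a support: `t i = 1` marks the coordinates that contribute the
-- factor `X`.
open Polynomial in
theorem hammingEigenvalue_eq_coeff {n : ℕ} (j : ℕ) (u : Fin n → ZMod 2) :
    hammingEigenvalue j u = (∏ i, (1 + C (bitSign (u i)) * X)).coeff j := by
  have h := Finset.prod_univ_sum (fun _ : Fin n => (Finset.univ : Finset (ZMod 2)))
    (fun i a => C (bitSign (u i * a)) * X ^ (if a = 0 then 0 else 1))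
  rw [Fintype.piFinset_univ] at h
  have h2 : ∀ i, ∑ a : ZMod 2, C (bitSign (u i * a)) * X ^ (if a = 0 then 0 else 1) =
      1 + C (bitSign (u i)) * X := by
    intro i
    rw [show (Finset.univ : Finset (ZMod 2)) = {0, 1} from rfl, Finset.sum_pair (by decide)]
    simp [bitSign]
  simp only [h2] at h
  rw [h, finsetSum_coeff, hammingEigenvalue]
  refine Finset.sum_congr rfl fun t _ => ?_
  have h3 : ∑ i, (if t i = 0 then 0 else 1) = hammingNorm t := by
    rw [hammingNorm, Finset.card_filter]
    exact Finset.sum_congr rfl fun i _ => by split_ifs <;> simp_all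
  rw [Finset.prod_mul_distrib, Finset.prod_pow_eq_pow_sum, h3, ← map_prod, coeff_C_mul_X_pow]
  simp only [cubeChar, eq_comm]

theorem hammingEigenvalue_zero_right {n : ℕ} (j : ℕ) :
    hammingEigenvalue j (0 : Fin n → ZMod 2) = n.choose j := by
  rw [hammingEigenvalue_eq_coeff]
  simp [bitSign, Polynomial.coeff_one_add_X_pow]

theorem hammingEigenvalue_zero_left {n : ℕ} (u : Fin n → ZMod 2) :
    hammingEigenvalue 0 u = 1 := by
  simp [hammingEigenvalue, cubeChar, bitSign]

theorem isKrawtchoukSeq_hammingEigenvalue {n : ℕ} (u : Fin n → ZMod 2) :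
    IsKrawtchoukSeq n (∑ i, bitSign (u i)) (fun k => hammingEigenvalue k u) := by
  simp only [hammingEigenvalue_eq_coeff]
  exact isKrawtchoukSeq_coeff _ fun i => bitSign_sq _

/-- Diagonalization of the adjacency form; after expansion, orthogonality of characters leaves only
`t = v + w`. The case `j = 0` is Parseval's identity. -/
theorem sum_hammingEigenvalue_mul_sq {n : ℕ} (j : ℕ) (f : (Fin n → ZMod 2) → ℝ) :
    ∑ u, hammingEigenvalue j u * (∑ v, cubeChar u v * f v) ^ 2 =
      2 ^ n * ∑ v, ∑ w, if hammingDist v w = j then f v * f w else 0 := by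
  have hneg (w : Fin n → ZMod 2) : -w = w := funext fun i => ZMod.neg_eq_self_mod_two (w i)
  have key : ∀ v w t : Fin n → ZMod 2, t + v + w = 0 ↔ v + w = t := by
    intro v w t
    have : v + w = t ↔ v + w - t = 0 := sub_eq_zero.symm
    rw [this, sub_eq_add_neg, hneg]
    constructor <;> intro h <;> rw [← h] <;> abel
  calc ∑ u, hammingEigenvalue j u * (∑ v, cubeChar u v * f v) ^ 2
      = ∑ u, ∑ v, ∑ w, ∑ t : Fin n → ZMod 2,
          (if hammingNorm t = j then f v * f w else 0) * cubeChar u (t + v + w) := by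
        refine Finset.sum_congr rfl fun u _ => ?_
        rw [sq, Finset.sum_mul_sum, Finset.mul_sum]
        refine Finset.sum_congr rfl fun v _ => ?_
        rw [Finset.mul_sum]
        refine Finset.sum_congr rfl fun w _ => ?_
        rw [hammingEigenvalue, Finset.sum_mul]
        refine Finset.sum_congr rfl fun t _ => ?_
        rw [cubeChar_add, cubeChar_add]
        split_ifs <;> ring
    _ = ∑ v, ∑ w, ∑ t : Fin n → ZMod 2,
          (if hammingNorm t = j then f v * f w else 0) * ∑ u, cubeChar u (t + v + w) := by
        rw [Finset.sum_comm]
        refine Finset.sum_congr rfl fun v _ => ?_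
        rw [Finset.sum_comm]
        refine Finset.sum_congr rfl fun w _ => ?_
        rw [Finset.sum_comm]
        exact Finset.sum_congr rfl fun t _ => (Finset.mul_sum _ _ _).symm
    _ = _ := by
        simp only [sum_cubeChar, key, mul_ite, mul_zero, Finset.sum_ite_eq, Finset.mem_univ,
          if_true, Finset.mul_sum]
        refine Finset.sum_congr rfl fun v _ => Finset.sum_congr rfl fun w _ => ?_
        have : hammingDist v w = hammingNorm (v + w) := by
          rw [hammingDist_eq_hammingNorm, neg_add_eq_sub, sub_eq_add_neg, hneg, add_comm]
        rw [this]
        split_ifs <;> ring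

theorem sum_sq_sum_cubeChar_mul {n : ℕ} (f : (Fin n → ZMod 2) → ℝ) :
    ∑ u, (∑ v, cubeChar u v * f v) ^ 2 = 2 ^ n * ∑ v, f v ^ 2 := by
  have := sum_hammingEigenvalue_mul_sq 0 f
  simpa [hammingEigenvalue_zero_left, hammingDist_eq_zero, sq] using this

/-- All shifted eigenvalues are nonnegative, so the spectral sum dominates its trivial-character
term. -/
theorem hammingGraph_form_inequality {n j : ℕ} {m : ℝ}
    (hm : ∀ u : Fin n → ZMod 2, -m ≤ hammingEigenvalue j u) (f : (Fin n → ZMod 2) → ℝ) :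
    (n.choose j + m) * (∑ v, f v) ^ 2 ≤
      2 ^ n * ((∑ v, ∑ w, if hammingDist v w = j then f v * f w else 0) + m * ∑ v, f v ^ 2) := by
  calc (n.choose j + m) * (∑ v, f v) ^ 2
      = (hammingEigenvalue j 0 + m) * (∑ v, cubeChar 0 v * f v) ^ 2 := by
        simp [hammingEigenvalue_zero_right, cubeChar_zero_left]
    _ ≤ ∑ u, (hammingEigenvalue j u + m) * (∑ v, cubeChar u v * f v) ^ 2 :=
        Finset.single_le_sum
          (f := fun u => (hammingEigenvalue j u + m) * (∑ v, cubeChar u v * f v) ^ 2)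
          (fun u _ => mul_nonneg (by linarith [hm u]) (sq_nonneg _)) (Finset.mem_univ 0)
    _ = _ := by
        simp only [add_mul, Finset.sum_add_distrib]
        rw [sum_hammingEigenvalue_mul_sq, ← Finset.mul_sum, sum_sq_sum_cubeChar_mul]
        ring

/-! ### Hoffman bound for quantum colorings -/

namespace IsQuantumColoring

variable {V : Type*} {G : SimpleGraph V} {c d : ℕ}
  {P : V → Fin c → Matrix (Fin d) (Fin d) ℂ}

/-- The real Frobenius inner product of Hermitian matrices; it lets a scalar quadratic form be
applied entry by entry. -/
theorem sum_re_mul_add_im_mul (h : IsQuantumColoring G c d P) (v w : V) (i : Fin c) :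
    ∑ a, ∑ b, ((P v i a b).re * (P w i a b).re + (P v i a b).im * (P w i a b).im) =
      (P v i * P w i).trace.re := by
  simp only [Matrix.trace, Matrix.diag, Matrix.mul_apply, Complex.re_sum]
  refine Finset.sum_congr rfl fun a _ => Finset.sum_congr rfl fun b _ => ?_
  have hs : star (P w i) = P w i := (h.isStarProjection w i).isSelfAdjoint
  have : P w i b a = star (P w i a b) := by
    conv_lhs => rw [← hs]
    rfl
  rw [this]
  simp [Complex.mul_re]

/-- The Hoffman bound for quantum colorings: a quadratic form inequality for the adjacency matrix
bounds the number of colors from below. -/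
theorem hoffman_bound [Fintype V] [DecidableRel G.Adj] [Nonempty V] (h : IsQuantumColoring G c d P) (hd : 0 < d) {l m : ℝ}
    (hl : 0 ≤ l)
    (hform : ∀ f : V → ℝ, l * (∑ v, f v) ^ 2 ≤
      Fintype.card V * ((∑ v, ∑ w, if G.Adj v w then f v * f w else 0) + m * ∑ v, f v ^ 2)) :
    l ≤ c * m := by
  set N : ℝ := (Fintype.card V : ℝ) with hN
  have hNpos : 0 < N := by rw [hN]; exact_mod_cast Fintype.card_pos
  -- The form is applied to the real and imaginary parts of each entry, then summed: edge terms
  -- vanish by orthogonality, and the squares add up to traces by idempotence.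
  have hcol : ∀ i, l * ∑ a, ∑ b, ((∑ v, (P v i a b).re) ^ 2 + (∑ v, (P v i a b).im) ^ 2) ≤
      N * m * ∑ v, (P v i).trace.re := by
    intro i
    have hadj : ∑ a, ∑ b, ((∑ v, ∑ w, if G.Adj v w then (P v i a b).re * (P w i a b).re else 0) +
        (∑ v, ∑ w, if G.Adj v w then (P v i a b).im * (P w i a b).im else 0)) = 0 := by
      simp only [← Finset.sum_add_distrib]
      calc _ = ∑ v, ∑ w, ∑ a, ∑ b,
            ((if G.Adj v w then (P v i a b).re * (P w i a b).re else 0) +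
              (if G.Adj v w then (P v i a b).im * (P w i a b).im else 0)) := by
            rw [← Finset.sum_product']
            rw [Finset.sum_comm]
            refine Finset.sum_congr rfl fun v _ => ?_
            rw [Finset.sum_comm]
            refine Finset.sum_congr rfl fun w _ => ?_
            rw [Finset.sum_product]
        _ = 0 := by
            refine Finset.sum_eq_zero fun v _ => Finset.sum_eq_zero fun w _ => ?_
            by_cases hvw : G.Adj v w
            · simp only [hvw, if_true]
              rw [h.sum_re_mul_add_im_mul, h.mul_eq_zero v w hvw i]
              simp
            · simp [hvw]
    have hsq : ∑ a, ∑ b, ((∑ v, (P v i a b).re ^ 2) + ∑ v, (P v i a b).im ^ 2) =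
        ∑ v, (P v i).trace.re := by
      simp only [← Finset.sum_add_distrib]
      rw [← Finset.sum_product', Finset.sum_comm]
      refine Finset.sum_congr rfl fun v _ => ?_
      rw [Finset.sum_product]
      have := h.sum_re_mul_add_im_mul v v i
      rw [(h.isStarProjection v i).isIdempotentElem.eq] at this
      simpa only [sq] using this
    calc l * ∑ a, ∑ b, ((∑ v, (P v i a b).re) ^ 2 + (∑ v, (P v i a b).im) ^ 2)
        = ∑ a, ∑ b, (l * (∑ v, (P v i a b).re) ^ 2 + l * (∑ v, (P v i a b).im) ^ 2) := by
          simp only [Finset.mul_sum, mul_add]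
      _ ≤ ∑ a, ∑ b, N * (((∑ v, ∑ w, if G.Adj v w then (P v i a b).re * (P w i a b).re else 0) +
            (∑ v, ∑ w, if G.Adj v w then (P v i a b).im * (P w i a b).im else 0)) +
            m * ((∑ v, (P v i a b).re ^ 2) + ∑ v, (P v i a b).im ^ 2)) := by
          refine Finset.sum_le_sum fun a _ => Finset.sum_le_sum fun b _ => ?_
          linarith [hform fun v => (P v i a b).re, hform fun v => (P v i a b).im]
      _ = N * m * ∑ v, (P v i).trace.re := by
          rw [← hsq]
          simp only [← Finset.mul_sum]
          rw [mul_assoc N]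
          congr 1
          conv_lhs => enter [2, a]; rw [Finset.sum_add_distrib, ← Finset.mul_sum]
          rw [Finset.sum_add_distrib, ← Finset.mul_sum, hadj, zero_add]
  have htr : ∑ i, ∑ v, (P v i).trace.re = N * d := by
    rw [Finset.sum_comm]
    have : ∀ v, ∑ i, (P v i).trace.re = d := by
      intro v
      rw [← Complex.re_sum, ← Matrix.trace_sum, h.sum_eq_one v]
      simp
    simp [this, hN]
  have hentry : ∀ a b, ∑ i, ∑ v, P v i a b = if a = b then (N : ℂ) else 0 := by
    intro a b
    rw [Finset.sum_comm]
    have : ∀ v, ∑ i, P v i a b = if a = b then 1 else 0 := by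
      intro v
      rw [← Matrix.sum_apply, h.sum_eq_one v, Matrix.one_apply]
    simp only [this]
    split_ifs <;> simp [hN]
  -- Cauchy–Schwarz over the colors for the entries of `∑ v, P v i`, which sum over `i` to `N` times
  -- the identity.
  have hCS : ∀ a b, (if a = b then N ^ 2 else 0) ≤
      c * ∑ i, ((∑ v, (P v i a b).re) ^ 2 + (∑ v, (P v i a b).im) ^ 2) := by
    intro a b
    have h1 := sq_sum_le_card_mul_sum_sq (s := (Finset.univ : Finset (Fin c)))
      (f := fun i => ∑ v, (P v i a b).re)
    have h3 : ∑ i, ∑ v, (P v i a b).re = if a = b then N else 0 := by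
      have := congrArg Complex.re (hentry a b)
      rw [Complex.re_sum] at this
      simp only [Complex.re_sum] at this
      rw [this]
      split_ifs <;> simp
    rw [Finset.card_univ, Fintype.card_fin, h3] at h1
    rw [Finset.sum_add_distrib, mul_add]
    have h4 : (0 : ℝ) ≤ c * ∑ i, (∑ v, (P v i a b).im) ^ 2 := by positivity
    split_ifs with hab
    · rw [if_pos hab] at h1
      linarith
    · positivity
  have hlow : N ^ 2 * d ≤
      c * ∑ i, ∑ a, ∑ b, ((∑ v, (P v i a b).re) ^ 2 + (∑ v, (P v i a b).im) ^ 2) := by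
    calc N ^ 2 * d = ∑ a : Fin d, ∑ b : Fin d, (if a = b then N ^ 2 else 0) := by
          simp [mul_comm]
      _ ≤ ∑ a, ∑ b, c * ∑ i, ((∑ v, (P v i a b).re) ^ 2 + (∑ v, (P v i a b).im) ^ 2) :=
          Finset.sum_le_sum fun a _ => Finset.sum_le_sum fun b _ => hCS a b
      _ = _ := by
          simp only [← Finset.mul_sum]
          congr 1
          rw [← Finset.sum_product', Finset.sum_comm]
          exact Finset.sum_congr rfl fun i _ => Finset.sum_product _ _ _
  have hup := Finset.sum_le_sum fun i (_ : i ∈ Finset.univ) => hcol i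
  rw [← Finset.mul_sum, ← Finset.mul_sum, htr] at hup
  have hd' : (0 : ℝ) < d := by exact_mod_cast hd
  have h1 := mul_le_mul_of_nonneg_left hlow hl
  rw [mul_left_comm l (c : ℝ)] at h1
  replace h1 := h1.trans (mul_le_mul_of_nonneg_left hup c.cast_nonneg)
  have h2 : l * (N ^ 2 * d) ≤ c * m * (N ^ 2 * d) := by linarith
  exact le_of_mul_le_mul_right h2 (by positivity)

end IsQuantumColoring

/-- A classical coloring makes the set nonempty, so `sInf` is attained and is not the default value
`0`. -/
theorem quantumColorable_quantumChromaticNumber {V : Type*} [Finite V] (G : SimpleGraph V) :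
    QuantumColorable G (quantumChromaticNumber G) := by
  have := Fintype.ofFinite V
  exact Nat.sInf_mem (s := {c | QuantumColorable G c}) ⟨_, .of_colorable G.colorable_of_fintype⟩

/-! ### Stirling estimates for binomial coefficients -/

-- The Stirling sequence is antitone, so it is bounded by its first value `exp 1 / √2`.
open Nat in
theorem factorial_le_stirling {n : ℕ} (hn : 0 < n) :
    (n ! : ℝ) ≤ Real.exp 1 * √n * (n / Real.exp 1) ^ n := by
  obtain ⟨k, rfl⟩ : ∃ k, n = k + 1 := ⟨n - 1, by omega⟩
  have h := Stirling.stirlingSeq'_antitone (Nat.zero_le k)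
  simp only [Function.comp, Nat.succ_eq_add_one, zero_add] at h
  rw [Stirling.stirlingSeq_one, Stirling.stirlingSeq, div_le_iff₀ (by positivity)] at h
  refine h.trans (le_of_eq ?_)
  rw [Real.sqrt_mul (by norm_num)]
  field_simp

open Nat in
/-- The binomial distribution with success probability `j / n` has mass at least
`1 / (e ^ 2 * √j)` at its mean. -/
theorem one_le_choose_mul {n j : ℕ} (hj : 0 < j) (hjn : j < n) {α : ℝ} (hα : (j : ℝ) = α * n) :
    1 ≤ (n.choose j : ℝ) * (Real.exp 1 ^ 2 * √j) * (α ^ j * (1 - α) ^ (n - j)) := by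
  obtain ⟨k, rfl⟩ : ∃ k, n = j + k := ⟨n - j, by omega⟩
  have hk : 0 < k := by omega
  have hj' : (0 : ℝ) < j := by exact_mod_cast hj
  have hk' : (0 : ℝ) < k := by exact_mod_cast hk
  have hα1 : α = j / (j + k) := by
    rw [eq_div_iff (by positivity)]; push_cast at hα; linarith
  have hα2 : 1 - α = k / (j + k) := by rw [hα1]; field_simp; ring
  rw [hα2, hα1, Nat.add_sub_cancel_left]
  have hfac : ((j + k).choose j : ℝ) * j ! * k ! = (j + k)! := by
    have := Nat.choose_mul_factorial_mul_factorial (Nat.le_add_right j k)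
    rw [Nat.add_sub_cancel_left] at this
    exact_mod_cast this
  -- Weakening `√(2π(j + k))` to `√k` lets it cancel against the `√k` from `k !`.
  have h1 : √k * (((j : ℝ) + k) / Real.exp 1) ^ (j + k) ≤ (j + k)! := by
    refine le_trans ?_ (Stirling.le_factorial_stirling (j + k))
    push_cast
    gcongr
    nlinarith [Real.pi_gt_three]
  rw [← hfac] at h1
  have h2 : √k * (((j : ℝ) + k) / Real.exp 1) ^ (j + k) ≤ ((j + k).choose j : ℝ) *
      (Real.exp 1 * √j * (j / Real.exp 1) ^ j) * (Real.exp 1 * √k * (k / Real.exp 1) ^ k) := by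
    refine h1.trans ?_
    gcongr
    · exact factorial_le_stirling hj
    · exact factorial_le_stirling hk
  have he := Real.exp_pos 1
  have hsk : 0 < √(k : ℝ) := Real.sqrt_pos.2 hk'
  have hpos : 0 < √(k : ℝ) * (((j : ℝ) + k) / Real.exp 1) ^ (j + k) := by positivity
  rw [← one_mul (√(k : ℝ) * _)] at h2
  refine le_of_mul_le_mul_right (h2.trans (le_of_eq ?_)) hpos
  simp only [div_pow, pow_add]
  field_simp

/-! ### Lower bounds for the quantum chromatic number -/

theorem quantumColorable_hammingGraph_bound {n j c : ℕ} (hj0 : 0 < j) (hje : Even j)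
    (hj : 3 * j ≤ n + 2) (hc : QuantumColorable (hammingGraph n j) c) {r : ℝ} (hr : 0 < r) :
    (n.choose j : ℝ) * r ^ j ≤
      c * Real.exp (2 * √(j * ((n : ℝ) - j)) * r + n * r ^ 2 / 2) := by
  classical
  obtain ⟨d, P, hd, hP⟩ := hc
  set m : ℝ := Real.exp (2 * √(j * ((n : ℝ) - j)) * r + n * r ^ 2 / 2) / r ^ j with hm
  have hm0 : 0 < m := by positivity
  have hadj : ∀ v w, (hammingGraph n j).Adj v w ↔ hammingDist v w = j := by
    intro v w
    refine ⟨fun h => h.2, fun h => ⟨?_, h⟩⟩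
    rintro rfl
    rw [hammingDist_self] at h
    omega
  have := hP.hoffman_bound (l := n.choose j + m) (m := m) hd (by positivity) (fun f => by
    have hf := hammingGraph_form_inequality (j := j) (m := m)
      (fun u => (isKrawtchoukSeq_hammingEigenvalue u).neg_le hj0 hje hj hr) f
    simpa [hadj, ZMod.card] using hf)
  have h2 : (n.choose j : ℝ) ≤ c * m := by linarith
  rwa [hm, ← mul_div_assoc, le_div_iff₀ (by positivity)] at h2

/-- Substituting `r = t * √α` makes both terms of the exponent multiples of `j = α * n`. -/
theorem quantumColorable_hammingGraph_bound_density {n j c : ℕ} (hj0 : 0 < j) (hje : Even j)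
    (hj : 3 * j ≤ n + 2) (hc : QuantumColorable (hammingGraph n j) c) {α t : ℝ} (ht : 0 < t)
    (hα : (j : ℝ) = α * n) :
    (n.choose j : ℝ) * (t * √α) ^ j ≤ c * Real.exp (2 * t * √(1 - α) + t ^ 2 / 2) ^ j := by
  have hj' : (0 : ℝ) < j := by exact_mod_cast hj0
  have hα0 : 0 < α := pos_of_mul_pos_left (hα ▸ hj') n.cast_nonneg
  have h := quantumColorable_hammingGraph_bound hj0 hje hj hc
    (show 0 < t * √α by positivity)
  refine h.trans (le_of_eq ?_)
  rw [← Real.exp_nat_mul]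
  congr 2
  have h1 : (j : ℝ) * (n - j) = (n * √α) ^ 2 * (1 - α) := by
    rw [mul_pow, Real.sq_sqrt hα0.le, hα]; ring
  rw [h1, Real.sqrt_mul (by positivity), Real.sqrt_sq (by positivity), hα]
  linear_combination (2 * n * √(1 - α) * t + n * t ^ 2 / 2) * Real.sq_sqrt hα0.le

theorem two_rpow_binaryEntropy_pow {n j : ℕ} (hjn : j ≤ n) {α : ℝ} (h0 : 0 < α) (h1 : α < 1)
    (hα : (j : ℝ) = α * n) :
    ((2 : ℝ) ^ binaryEntropy α) ^ n * (α ^ j * (1 - α) ^ (n - j)) = 1 := by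
  have h1' : 0 < 1 - α := by linarith
  have e : (2 : ℝ) ^ binaryEntropy α = Real.exp (-(α * Real.log α + (1 - α) * Real.log (1 - α))) := by
    rw [Real.rpow_def_of_pos two_pos, binaryEntropy, Real.logb, Real.logb]
    have : Real.log 2 ≠ 0 := (Real.log_pos one_lt_two).ne'
    congr 1
    field_simp
    ring
  have e1 : α ^ j = Real.exp (j * Real.log α) := by
    rw [Real.exp_nat_mul, Real.exp_log h0]
  have e2 : (1 - α) ^ (n - j) = Real.exp ((n - j : ℕ) * Real.log (1 - α)) := by
    rw [Real.exp_nat_mul, Real.exp_log h1']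
  rw [e, e1, e2, ← Real.exp_nat_mul, ← Real.exp_add, ← Real.exp_add, Real.exp_eq_one_iff,
    Nat.cast_sub hjn, hα]
  ring

/-- Here `t = 1`: the binomial is of order `n ^ j`, the factor `√(j / n) ^ j` costs `n ^ (j / 2)`,
and `5 / 2` bounds `2 * √(1 - α) + 1 / 2`. -/
theorem quantumChromaticNumber_hammingGraph_fixed {j : ℕ} (hj0 : 0 < j) (hje : Even j) {n : ℕ}
    (hn : 3 * j ≤ n) :
    Real.exp (5 / 2) ^ (-(j : ℤ)) / (2 ^ j * j.factorial) * (n : ℝ) ^ (j / 2) ≤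
      quantumChromaticNumber (hammingGraph n j) := by
  have hn0 : (0 : ℝ) < n := by exact_mod_cast (by omega : 0 < n)
  have hjn : 3 * (j : ℝ) ≤ n := by exact_mod_cast hn
  have hj1 : (1 : ℝ) ≤ j := by exact_mod_cast hj0
  have h := quantumColorable_hammingGraph_bound_density hj0 hje (by omega)
    (quantumColorable_quantumChromaticNumber (hammingGraph n j)) (α := j / n) one_pos
    (by field_simp)
  set q : ℝ := (quantumChromaticNumber (hammingGraph n j) : ℝ)
  have hexp : Real.exp (2 * 1 * √(1 - (j : ℝ) / n) + 1 ^ 2 / 2) ≤ Real.exp (5 / 2) := by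
    refine Real.exp_le_exp.2 ?_
    have : √(1 - (j : ℝ) / n) ≤ 1 := Real.sqrt_le_one.2 (by
      have : 0 ≤ (j : ℝ) / n := by positivity
      linarith)
    linarith
  have hchoose : ((n : ℝ) / 2) ^ j / j.factorial ≤ n.choose j := by
    refine le_trans ?_ (Nat.pow_le_choose j n)
    gcongr
    rw [Nat.cast_sub (by omega)]
    push_cast
    linarith
  have hα : ((n : ℝ) ^ (j / 2))⁻¹ ≤ (1 * √((j : ℝ) / n)) ^ j := by
    obtain ⟨i, rfl⟩ := hje
    rw [one_mul, ← two_mul, pow_mul, Real.sq_sqrt (by positivity),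
      Nat.mul_div_cancel_left _ two_pos, ← inv_pow, inv_eq_one_div]
    gcongr
    rwa [two_mul]
  have hnn : (n : ℝ) ^ j = (n : ℝ) ^ (j / 2) * (n : ℝ) ^ (j / 2) := by
    rw [← pow_add]; congr 1; obtain ⟨i, rfl⟩ := hje; omega
  have hmain : ((n : ℝ) / 2) ^ j / j.factorial * ((n : ℝ) ^ (j / 2))⁻¹ ≤
      q * Real.exp (5 / 2) ^ j :=
    calc _ ≤ (n.choose j : ℝ) * (1 * √((j : ℝ) / n)) ^ j := by gcongr
      _ ≤ _ := h
      _ ≤ _ := by gcongr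
  rw [zpow_neg, zpow_natCast, inv_eq_one_div, div_div, div_mul_eq_mul_div, one_mul,
    div_le_iff₀ (by positivity)]
  have hfin : (n : ℝ) ^ (j / 2) / (2 ^ j * j.factorial) ≤ q * Real.exp (5 / 2) ^ j := by
    refine le_trans (le_of_eq ?_) hmain
    rw [div_pow, hnn]
    field_simp
  rw [div_le_iff₀ (by positivity)] at hfin
  linarith

/-- The comparison for `t = √2 - 1` and `y = √(1 - α)`; `0.83` is `1 - 0.17`. It reduces to a
quadratic inequality in `y` through `1 - y⁻¹ ≤ log y`. -/
theorem sqrt_two_exponent_bound {y : ℝ} (hy0 : 0 < y) (hy : 0.83 ≤ y ^ 2) (hy1 : y ≤ 1) :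
    Real.exp (2 * (√2 - 1) * y + (√2 - 1) ^ 2 / 2) ≤
      Real.exp 1 * y * Real.exp (-(1 / 20)) := by
  have hy9 : 0.911 ≤ y := by nlinarith
  have hlog := Real.one_sub_inv_le_log_of_pos hy0
  have hs : √2 ^ 2 = (2 : ℝ) := Real.sq_sqrt (by norm_num)
  have hs1 : √2 ≤ (1.41422 : ℝ) := Real.sqrt_le_iff.2 (by norm_num)
  have hs2 : (1.4142 : ℝ) ≤ √2 := Real.le_sqrt_of_sq_le (by norm_num)
  have hkey : 2 * (√2 - 1) * y + (√2 - 1) ^ 2 / 2 ≤ 1 + (1 - y⁻¹) - 1 / 20 := by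
    have h1 : 2 * (√2 - 1) * y ≤ 0.82844 * y := by gcongr; linarith
    have h2 : (√2 - 1) ^ 2 / 2 ≤ 0.0859 := by nlinarith
    have h3 : y⁻¹ ≤ 1.8641 - 0.82844 * y := by
      rw [inv_le_iff_one_le_mul₀ hy0]
      nlinarith [mul_nonneg (sub_nonneg.2 hy9) (sub_nonneg.2 hy1)]
    linarith
  calc Real.exp (2 * (√2 - 1) * y + (√2 - 1) ^ 2 / 2)
      ≤ Real.exp (1 + Real.log y + -(1 / 20)) := Real.exp_le_exp.2 (by linarith)
    _ = _ := by rw [Real.exp_add, Real.exp_add, Real.exp_log hy0]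

theorem sqrt_mul_exp_neg_le (j : ℕ) : √(j : ℝ) * Real.exp (-(1 / 20)) ^ j ≤ 20 := by
  rw [← Real.exp_nat_mul, mul_neg, Real.exp_neg, ← div_eq_mul_inv, div_le_iff₀ (Real.exp_pos _)]
  have h1 := Real.add_one_le_exp ((j : ℝ) * (1 / 20))
  have h2 : √(j : ℝ) ≤ 1 + j := Real.sqrt_le_iff.2 ⟨by positivity, by nlinarith⟩
  linarith

theorem quantumChromaticNumber_hammingGraph_linear {α : ℝ} (h0 : 0 < α) (h1 : α ≤ 0.17)
    {n j : ℕ} (hn : 1 ≤ n) (hje : Even j) (hα : (j : ℝ) = α * n) :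
    1 / (20 * Real.exp 1 ^ 2) * ((2 : ℝ) ^ binaryEntropy α /
        (Real.exp 1 * (1 + √2) * √((1 - α) / α)) ^ α) ^ n ≤
      quantumChromaticNumber (hammingGraph n j) := by
  have hn0 : (1 : ℝ) ≤ n := by exact_mod_cast hn
  have hj' : (0 : ℝ) < j := by rw [hα]; positivity
  have hj0 : 0 < j := by exact_mod_cast hj'
  have hjn3 : 3 * j ≤ n + 2 := by
    have : 3 * (j : ℝ) ≤ n + 2 := by rw [hα]; nlinarith
    exact_mod_cast this
  have hjn : j < n := by
    have : (j : ℝ) < n := by rw [hα]; nlinarith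
    exact_mod_cast this
  have hα1 : 0 < 1 - α := by linarith
  have hs : √2 ^ 2 = (2 : ℝ) := Real.sq_sqrt (by norm_num)
  have hs1 : (1 : ℝ) < √2 := Real.lt_sqrt_of_sq_lt (by norm_num)
  have ht : (0 : ℝ) < √2 - 1 := by linarith
  set y := √(1 - α) with hy
  have hy0 : 0 < y := Real.sqrt_pos.2 hα1
  have hysq : y ^ 2 = 1 - α := Real.sq_sqrt hα1.le
  have hx0 : 0 < √α := Real.sqrt_pos.2 h0
  have hbound := quantumColorable_hammingGraph_bound_density hj0 hje hjn3
    (quantumColorable_quantumChromaticNumber (hammingGraph n j)) ht hα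
  set q : ℝ := (quantumChromaticNumber (hammingGraph n j) : ℝ)
  have hQ : 0 < Real.exp 1 * (1 + √2) * √((1 - α) / α) := by positivity
  -- Uses `(1 + √2)⁻¹ = √2 - 1`, which is why `t = √2 - 1` matches the stated base.
  have hpow : ((Real.exp 1 * (1 + √2) * √((1 - α) / α)) ^ α) ^ n =
      (Real.exp 1 * y) ^ j / ((√2 - 1) * √α) ^ j := by
    rw [← Real.rpow_mul_natCast hQ.le, ← hα, Real.rpow_natCast, ← div_pow]
    congr 1
    rw [Real.sqrt_div hα1.le, eq_div_iff (by positivity)]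
    field_simp
    linear_combination y * hs
  have hent : ((2 : ℝ) ^ binaryEntropy α) ^ n ≤ (n.choose j : ℝ) * (Real.exp 1 ^ 2 * √j) := by
    have e1 := two_rpow_binaryEntropy_pow hjn.le h0 (by linarith) hα
    have e2 := one_le_choose_mul hj0 hjn hα
    exact le_of_mul_le_mul_right (e1.trans_le e2) (by positivity)
  have hexp := sqrt_two_exponent_bound hy0 (by rw [hysq]; linarith)
    (Real.sqrt_le_one.2 (by linarith))
  have hq0 : 0 ≤ q := Nat.cast_nonneg _
  rw [div_pow, hpow, div_div_eq_mul_div, one_div, inv_mul_le_iff₀ (by positivity),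
    div_le_iff₀ (by positivity)]
  calc ((2 : ℝ) ^ binaryEntropy α) ^ n * ((√2 - 1) * √α) ^ j
      ≤ (n.choose j : ℝ) * (Real.exp 1 ^ 2 * √j) * ((√2 - 1) * √α) ^ j := by gcongr
    _ = (Real.exp 1 ^ 2 * √j) * ((n.choose j : ℝ) * ((√2 - 1) * √α) ^ j) := by ring
    _ ≤ (Real.exp 1 ^ 2 * √j) * (q * (Real.exp 1 * y * Real.exp (-(1 / 20))) ^ j) := by
        refine mul_le_mul_of_nonneg_left (hbound.trans ?_) (by positivity)
        gcongr
    _ = (Real.exp 1 ^ 2 * q * (Real.exp 1 * y) ^ j) * (√j * Real.exp (-(1 / 20)) ^ j) := by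
        rw [mul_pow (Real.exp 1 * y)]; ring
    _ ≤ (Real.exp 1 ^ 2 * q * (Real.exp 1 * y) ^ j) * 20 := by
        gcongr
        exact sqrt_mul_exp_neg_le j
    _ = _ := by ring

theorem mainTheorem4 :
    (∀ j : ℕ, 0 < j → Even j →
      ∃ c : ℝ, 0 < c ∧ ∃ N : ℕ, ∀ n : ℕ, N ≤ n →
        c * (n : ℝ) ^ (j / 2) ≤ (quantumChromaticNumber (hammingGraph n j) : ℝ)) ∧
    (∃ c : ℝ, 0 < c ∧ ∃ N : ℕ, ∀ α : ℝ, 0 < α → α ≤ 0.17 →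
      ∀ n j : ℕ, N ≤ n → Even j → (j : ℝ) = α * (n : ℝ) →
        c * ((2 : ℝ) ^ binaryEntropy α /
              (Real.exp 1 * (1 + Real.sqrt 2) * Real.sqrt ((1 - α) / α)) ^ α) ^ n
          ≤ (quantumChromaticNumber (hammingGraph n j) : ℝ)) := by
  refine ⟨fun j hj0 hje => ⟨_, ?_, 3 * j, fun n hn =>
    quantumChromaticNumber_hammingGraph_fixed hj0 hje hn⟩, _, ?_, 1, fun α h0 h1 n j hn hje hα =>
    quantumChromaticNumber_hammingGraph_linear h0 h1 hn hje hα⟩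
  · positivity
  · positivity
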